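/- Definitions. All graphs are finite. Let $C_q$ be the cycle on $q$ vertices (for $q\ge 3$; as simple graphs, $C_0$ is the empty graph, $C_1$ is a single vertex without edges, and $C_2$ is a single edge on two vertices). For $k\in\mathbb N=\{0,1,2,\ldots\}$ let $C_q^k$ be the Cartesian product of $k$ copies of $C_q$: its vertices are the $k$-tuples of vertices of $C_q$, and two $k$-tuples are adjacent when their entries in one coordinate are adjacent in $C_q$ and their entries in every other coordinate are equal (so $C_q^0$ is a single vertex). For a graph $G$, the chromatic polynomial $\chi_G(n)$ is the polynomial whose value at each $n\in\mathbb N$ is the number of proper vertex colorings of $G$ with $n$ colors. A numerical polynomial is a $g\in\mathbb Q[x]$ with $g(z)\in\mathbb Z$ for all $z\in\mathbb Z$. Let $g$ be a numerical polynomial with $g(q)\ge 0$ for all sufficiently large $q$, let $S=\{q\in\mathbb N : g(q)\ge 0\}$, and let $e:S\to\mathbb N\cup\{-1,\infty\}$. A two-level polynomial of degree $g$ and depth $e$ is a sequence of polynomials $\{f_q\}_{q\in S}$ in $\mathbb Q[n]$, with $f_q$ of degree exactly $g(q)$, such that, writing \[ f_q(n)=\sum_{r=0}^{\infty} c_r(q)\,n^{g(q)-r},\qquad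 c_r(q)=0 \text{ for } r>g(q), \] there exist polynomials $\phi_r\in\mathbb Q[x]$ $(r\ge 0)$ with $c_r(q)=\phi_r(q)$ for every $q\in S$ and every integer $r$ with $0\le r\le e(q)$. (For $q\in\mathbb N\setminus S$ one sets $f_q=0$ and $e(q)=-1$.) Theorem. For every fixed $k\in\mathbb N$, the sequence of chromatic polynomials $\{\chi_{C_q^k}(n)\}_{q\in\mathbb N}$ is a two-level polynomial of degree $g(q)=q^k$ and depth $e(q)=\max(q-2,-1)$; that is, of depth $q-2$ for every $q\ge 1$, and of depth $-1$ for $q=0$. (Here $g$ is the polynomial $x^k$, so $q^0=1$ for every $q$.) -/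

import Mathlib

open Polynomial

/-- The Cartesian power `G^k`: vertices are the `k`-tuples of vertices of `G`, and two tuples are
adjacent when they are adjacent in `G` in one coordinate and agree in all the others. -/
def SimpleGraph.cartesianPower {V : Type*} (G : SimpleGraph V) (k : ℕ) :
    SimpleGraph (Fin k → V) where
  Adj x y := ∃ i, G.Adj (x i) (y i) ∧ ∀ j, j ≠ i → x j = y j
  symm := ⟨fun _ _ ⟨i, h, h'⟩ => ⟨i, h.symm, fun j hj => (h' j hj).symm⟩⟩
  loopless := ⟨fun _ ⟨_, h, _⟩ => h.ne rfl⟩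

/-- The colorings with a given partition into color classes: there are none when some class
contains an edge, and otherwise they are the injections from the classes to the colors. -/
theorem SimpleGraph.card_coloring_ker {V : Type*} [Finite V] (G : SimpleGraph V) (s : Setoid V) :
    ∃ p : ℚ[X], ∀ n : ℕ,
      p.eval (n : ℚ) = Nat.card {c : G.Coloring (Fin n) // Setoid.ker c = s} := by
  classical
  by_cases hs : ∀ u v, G.Adj u v → ¬ s u v
  · refine ⟨descPochhammer ℚ (Nat.card (Quotient s)), fun n => ?_⟩
    have e : {c : G.Coloring (Fin n) // Setoid.ker c = s} ≃ (Quotient s ↪ Fin n) :=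
      { toFun := fun c => ⟨Quotient.lift (c.1 : V → Fin n)
            (fun a b h => by
              have h' : (Setoid.ker c.1) a b := by rw [c.2]; exact h
              exact h'), by
          intro x y
          induction x using Quotient.inductionOn with | _ a =>
          induction y using Quotient.inductionOn with | _ b =>
          intro h
          have h' : (Setoid.ker c.1) a b := h
          rw [c.2] at h'
          exact Quotient.sound h'⟩
        invFun := fun f => ⟨SimpleGraph.Coloring.mk (fun v => f (Quotient.mk s v))
            (fun {u v} huv h => hs u v huv (Quotient.exact (f.injective h))), by
          ext a b
          constructor
          · intro h
            exact Quotient.exact (f.injective h)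
          · intro h
            exact congrArg f (Quotient.sound h)⟩
        left_inv := fun c => by ext; rfl
        right_inv := fun f => by
          ext x
          induction x using Quotient.inductionOn with | _ a => rfl }
    have := Fintype.ofFinite (Quotient s)
    rw [Nat.card_congr e, descPochhammer_eval_eq_descFactorial,
      Nat.card_eq_fintype_card (α := Quotient s), Nat.card_eq_fintype_card,
      Fintype.card_embedding_eq, Fintype.card_fin]
  · refine ⟨0, fun n => ?_⟩
    push Not at hs
    obtain ⟨u, v, huv, h⟩ := hs
    have : IsEmpty {c : G.Coloring (Fin n) // Setoid.ker c = s} := ⟨fun c => by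
      have h' : (Setoid.ker c.1) u v := by rw [c.2]; exact h
      exact c.1.valid huv h'⟩
    simp

/-- For a finite graph `G` there is exactly one polynomial whose value at every natural number `n`
is the number of proper vertex colorings of `G` with `n` colors. -/
theorem SimpleGraph.existsUnique_chromaticPolynomial {V : Type*} [Finite V] (G : SimpleGraph V) :
    ∃! p : ℚ[X], ∀ n : ℕ, p.eval (n : ℚ) = Nat.card (G.Coloring (Fin n)) := by
  classical
  choose p hp using G.card_coloring_ker
  have : Finite (Setoid V) := Finite.of_injective (fun s : Setoid V => (s : V → V → Prop))
    (fun s t h => Setoid.ext fun a b => iff_of_eq (congrFun (congrFun h a) b))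
  have := Fintype.ofFinite (Setoid V)
  refine ⟨∑ s, p s, fun n => ?_, fun p' hp' => ?_⟩
  · have : Finite (G.Coloring (Fin n)) :=
      Finite.of_injective (fun c : G.Coloring (Fin n) => (c : V → Fin n)) DFunLike.coe_injective
    rw [Polynomial.eval_finsetSum,
      ← Nat.card_congr (Equiv.sigmaFiberEquiv fun c : G.Coloring (Fin n) => Setoid.ker c),
      Nat.card_sigma]
    push_cast
    exact Finset.sum_congr rfl fun s _ => hp s n
  · refine Polynomial.eq_of_infinite_eval_eq _ _
      ((Set.infinite_range_of_injective (Nat.cast_injective (R := ℚ))).mono ?_)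
    rintro _ ⟨n, rfl⟩
    simp only [Set.mem_ofPred_eq]
    rw [hp' n, Polynomial.eval_finsetSum,
      ← Nat.card_congr (Equiv.sigmaFiberEquiv fun c : G.Coloring (Fin n) => Setoid.ker c)]
    have : Finite (G.Coloring (Fin n)) :=
      Finite.of_injective (fun c : G.Coloring (Fin n) => (c : V → Fin n)) DFunLike.coe_injective
    rw [Nat.card_sigma]
    push_cast
    exact Finset.sum_congr rfl fun s _ => (hp s n).symm

/-- The chromatic polynomial of a finite graph: the polynomial whose value at every natural
number `n` is the number of proper vertex colorings with `n` colors. -/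
noncomputable def SimpleGraph.chromaticPolynomial {V : Type*} [Finite V] (G : SimpleGraph V) :
    ℚ[X] :=
  G.existsUnique_chromaticPolynomial.choose

theorem SimpleGraph.chromaticPolynomial_eval {V : Type*} [Finite V] (G : SimpleGraph V) (n : ℕ) :
    G.chromaticPolynomial.eval (n : ℚ) = Nat.card (G.Coloring (Fin n)) :=
  G.existsUnique_chromaticPolynomial.choose_spec.1 n

/-- The codegree `r` coefficient of `p`: the coefficient in degree `deg p - r`, and `0` when
`r > deg p`. -/
noncomputable def codegreeCoeff (p : ℚ[X]) (r : ℕ) : ℚ :=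
  if r ≤ p.natDegree then p.coeff (p.natDegree - r) else 0

/-- A numerical polynomial: rational coefficients, integer values on all integers. -/
def IsNumericalPolynomial (g : ℚ[X]) : Prop :=
  ∀ z : ℤ, ∃ m : ℤ, g.eval (z : ℚ) = m

/-- `f` is a two-level polynomial of degree `g` and depth `e`. A depth is an element of
`ℕ ∪ {-1, ∞}`, written as an element of `WithTop ℤ` that is at least `-1`. The set `S` of the
definition is `{q : ℕ | 0 ≤ g(q)}`; outside it, `f q = 0` and `e q = -1` by convention. -/
structure IsTwoLevelPolynomial (g : ℚ[X]) (e : ℕ → WithTop ℤ) (f : ℕ → ℚ[X]) : Prop where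
  numerical : IsNumericalPolynomial g
  eventually_nonneg : ∀ᶠ q : ℕ in Filter.atTop, 0 ≤ g.eval (q : ℚ)
  neg_one_le_depth : ∀ q : ℕ, ((-1 : ℤ) : WithTop ℤ) ≤ e q
  zero_of_neg : ∀ q : ℕ, g.eval (q : ℚ) < 0 → f q = 0 ∧ e q = ((-1 : ℤ) : WithTop ℤ)
  degree_eq : ∀ q : ℕ, 0 ≤ g.eval (q : ℚ) →
    f q ≠ 0 ∧ ((f q).natDegree : ℚ) = g.eval (q : ℚ)
  exists_coeff : ∃ φ : ℕ → ℚ[X], ∀ q : ℕ, 0 ≤ g.eval (q : ℚ) →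
    ∀ r : ℕ, ((r : ℤ) : WithTop ℤ) ≤ e q → codegreeCoeff (f q) r = (φ r).eval (q : ℚ)

/-!
Whitney's expansion says that the chromatic polynomial, read from the top coefficient down, is the
generating series `Z = ∑ A, (-1) ^ #A * X ^ rank A` of the edge sets `A` by their graphic rank. The
logarithmic derivative of `Z` is a sum of cluster weights, where the weight of `A` vanishes unless
`A` is connected and is divisible by `X ^ rank A`; so its coefficients in degrees up to `j` only see
connected edge sets of rank at most `j`. In the discrete torus of side `q`, a connected set of rank
at most `q - 2` misses a hyperplane in every direction. It therefore does not wrap around, and it is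
a translate of a shape in the infinite grid in exactly one way. Hence for `j ≤ q - 2` the degree `j`
coefficient is `q ^ k` times a constant that does not depend on `q`, and Newton's recursion turns
these polynomials in `q` into polynomials for the coefficients of `Z`.
-/

open Finset
open scoped PowerSeries

section MoebiusTransform

variable {E M R : Type*} [DecidableEq E]

section AddCommGroup

variable [AddCommGroup M]

/-- The Möbius transform of a set function `F` on the Boolean lattice of finite sets: the inverse
of the summation of a set function over all subsets. -/
def moebiusTransform (F : Finset E → M) (B : Finset E) : M :=
  ∑ A ∈ B.powerset, (-1 : ℤ) ^ #(B \ A) • F A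

theorem moebiusTransform_congr {F G : Finset E → M} {B : Finset E} (h : ∀ A ⊆ B, F A = G A) :
    moebiusTransform F B = moebiusTransform G B :=
  sum_congr rfl fun A hA => by rw [h A (mem_powerset.1 hA)]

theorem moebiusTransform_add (F G : Finset E → M) (B : Finset E) :
    moebiusTransform (fun A => F A + G A) B = moebiusTransform F B + moebiusTransform G B := by
  simp only [moebiusTransform, smul_add, sum_add_distrib]

theorem moebiusTransform_empty (F : Finset E → M) : moebiusTransform F ∅ = F ∅ := by
  simp [moebiusTransform]

theorem moebiusTransform_insert (F : Finset E → M) {a : E} {B : Finset E} (ha : a ∉ B) :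
    moebiusTransform F (insert a B) = moebiusTransform (fun A => F (insert a A) - F A) B := by
  simp only [moebiusTransform, sum_powerset_insert ha, ← sum_add_distrib]
  refine sum_congr rfl fun A hA => ?_
  have haA : a ∉ A := fun h => ha (mem_powerset.1 hA h)
  have haBA : a ∉ B \ A := fun h => ha (mem_sdiff.1 h).1
  rw [insert_sdiff_of_notMem _ haA, card_insert_of_notMem haBA, insert_sdiff_insert,
    sdiff_insert_of_notMem ha, pow_succ, mul_neg_one, neg_smul, smul_sub]
  abel

theorem moebiusTransform_eq_zero_of_insert_eq {F : Finset E → M} {a : E} {B : Finset E}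
    (ha : a ∈ B) (hF : ∀ A ⊆ B, F (insert a A) = F A) : moebiusTransform F B = 0 := by
  rw [← insert_erase ha, moebiusTransform_insert F (notMem_erase a B)]
  refine sum_eq_zero fun A hA => ?_
  have hAB : A ⊆ B := (mem_powerset.1 hA).trans (erase_subset a B)
  simp only [hF A hAB, sub_self, smul_zero]

theorem moebiusTransform_eq_zero_of_additive {F : Finset E → M} (p : E → Prop) [DecidablePred p]
    {B : Finset E} (hF : ∀ A ⊆ B, F A = F {e ∈ A | p e} + F {e ∈ A | ¬ p e})
    (hp : ∃ e ∈ B, p e) (hnp : ∃ e ∈ B, ¬ p e) : moebiusTransform F B = 0 := by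
  obtain ⟨a, haB, ha⟩ := hp
  obtain ⟨b, hbB, hb⟩ := hnp
  rw [moebiusTransform_congr hF, moebiusTransform_add,
    moebiusTransform_eq_zero_of_insert_eq hbB fun A _ => by rw [filter_insert, if_neg hb],
    moebiusTransform_eq_zero_of_insert_eq haB fun A _ => by
      rw [filter_insert, if_neg (not_not.2 ha)], add_zero]

theorem sum_powerset_moebiusTransform (F : Finset E → M) (B : Finset E) :
    ∑ A ∈ B.powerset, moebiusTransform F A = F B := by
  induction B using Finset.induction_on generalizing F with
  | empty => rw [powerset_empty, sum_singleton, moebiusTransform_empty]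
  | insert a B ha ih =>
    have hinsert : ∀ A ∈ B.powerset, moebiusTransform F (insert a A)
        = moebiusTransform (fun A => F (insert a A) - F A) A := fun A hA =>
      moebiusTransform_insert F fun h => ha (mem_powerset.1 hA h)
    rw [sum_powerset_insert ha, sum_congr rfl hinsert, ih, ih, add_sub_cancel]

theorem moebiusTransform_sum_powerset (f : Finset E → M) (B : Finset E) :
    moebiusTransform (fun A => ∑ C ∈ A.powerset, f C) B = f B := by
  induction B using Finset.induction_on generalizing f with
  | empty => rw [moebiusTransform_empty, powerset_empty, sum_singleton]
  | insert a B ha ih =>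
    rw [moebiusTransform_insert _ ha, ← ih fun C => f (insert a C)]
    refine moebiusTransform_congr fun A hA => ?_
    rw [sum_powerset_insert fun h => ha (hA h), add_sub_cancel_left]

theorem moebiusTransform_image {E' : Type*} [DecidableEq E'] {F : Finset E → M}
    {F' : Finset E' → M} {f : E → E'} {B : Finset E} (hf : Set.InjOn f B)
    (hF : ∀ A ⊆ B, F' (A.image f) = F A) :
    moebiusTransform F' (B.image f) = moebiusTransform F B := by
  rw [moebiusTransform, powerset_image, sum_image (image_injOn_powerset_of_injOn hf)]
  refine sum_congr rfl fun A hA => ?_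
  rw [mem_powerset] at hA
  rw [hF A hA, ← image_sdiff_of_injOn hf hA, card_image_of_injOn (hf.mono (by simp))]

end AddCommGroup

variable [CommRing R]

theorem sum_powerset_union_eq (f g : Finset E → R) (B : Finset E) :
    ∑ D ∈ B.powerset, ∑ P ∈ D.powerset ×ˢ D.powerset with P.1 ∪ P.2 = D, f P.1 * g P.2
      = (∑ P ∈ B.powerset, f P) * ∑ Q ∈ B.powerset, g Q := by
  have hunion : ∀ P ∈ B.powerset ×ˢ B.powerset, P.1 ∪ P.2 ∈ B.powerset := fun P hP => by
    rw [mem_product, mem_powerset, mem_powerset] at hP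
    exact mem_powerset.2 (union_subset hP.1 hP.2)
  rw [sum_mul_sum, ← sum_product', ← sum_fiberwise_of_maps_to hunion]
  refine sum_congr rfl fun D hD => sum_congr ?_ fun _ _ => rfl
  rw [mem_powerset] at hD
  ext P
  simp only [mem_filter, mem_product, mem_powerset, and_congr_left_iff]
  rintro rfl
  exact iff_of_true ⟨subset_union_left, subset_union_right⟩ (union_subset_iff.1 hD)

theorem moebiusTransform_mul (F G : Finset E → R) (B : Finset E) :
    moebiusTransform (fun A => F A * G A) B
      = ∑ P ∈ B.powerset ×ˢ B.powerset with P.1 ∪ P.2 = B,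
        moebiusTransform F P.1 * moebiusTransform G P.2 := by
  simp_rw [← moebiusTransform_sum_powerset (fun D => ∑ P ∈ D.powerset ×ˢ D.powerset with
      P.1 ∪ P.2 = D, moebiusTransform F P.1 * moebiusTransform G P.2) B,
    sum_powerset_union_eq, sum_powerset_moebiusTransform]

/-- In the expansion of the Möbius transform of `F * G` at `B`, the pairs `(P, B)` add up to
`F B * moebiusTransform G B`; in all other pairs `(P, Q)` the set `Q` is smaller than `B`. -/
theorem pow_dvd_moebiusTransform_of_mul {x : R} {ρ : Finset E → ℕ}
    (hρ : ∀ A B, ρ (A ∪ B) ≤ ρ A + ρ B) {F G : Finset E → R} (hu : ∀ B, IsUnit (F B))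
    (hF : ∀ B, x ^ ρ B ∣ moebiusTransform F B)
    (hFG : ∀ B, x ^ ρ B ∣ moebiusTransform (fun A => F A * G A) B) (B : Finset E) :
    x ^ ρ B ∣ moebiusTransform G B := by
  induction B using Finset.strongInduction with
  | H B ih =>
    have hexpand : moebiusTransform (fun A => F A * G A) B
        = F B * moebiusTransform G B + ∑ Q ∈ B.ssubsets, ∑ P ∈ B.powerset with P ∪ Q = B,
          moebiusTransform F P * moebiusTransform G Q := by
      have htop : {P ∈ B.powerset | P ∪ B = B} = B.powerset :=
        filter_true_of_mem fun P hP => union_eq_right.2 (mem_powerset.1 hP)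
      rw [moebiusTransform_mul, sum_filter, sum_product_right, ssubsets,
        ← add_sum_erase _ _ (mem_powerset_self B)]
      simp only [← sum_filter]
      rw [htop, ← sum_mul, sum_powerset_moebiusTransform]
    have hsmaller : x ^ ρ B ∣ ∑ Q ∈ B.ssubsets, ∑ P ∈ B.powerset with P ∪ Q = B,
        moebiusTransform F P * moebiusTransform G Q := by
      refine dvd_sum fun Q hQ => dvd_sum fun P hP => ?_
      have hle : ρ B ≤ ρ P + ρ Q := (mem_filter.1 hP).2 ▸ hρ P Q
      rw [mem_ssubsets] at hQ
      exact ((pow_dvd_pow x hle).trans (pow_add x _ _).dvd).trans (mul_dvd_mul (hF P) (ih Q hQ))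
    have hB := hFG B
    rwa [hexpand, dvd_add_left hsmaller, (hu B).dvd_mul_left] at hB

end MoebiusTransform

section EulerLogDeriv

theorem coeff_X_mul_derivative {R : Type*} [CommSemiring R] (F : R⟦X⟧) (n : ℕ) :
    PowerSeries.coeff n (PowerSeries.X * PowerSeries.derivative R F)
      = n * PowerSeries.coeff n F := by
  cases n with
  | zero => rw [PowerSeries.coeff_zero_X_mul, Nat.cast_zero, zero_mul]
  | succ n =>
    rw [PowerSeries.coeff_succ_X_mul, PowerSeries.coeff_derivative, Nat.cast_succ, mul_comm]

variable {K : Type*} [Field K]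

/-- The logarithmic Euler derivative `X F' / F`, which stands in for the logarithm of `F`.
The value is `0` when the constant coefficient of `F` vanishes. -/
noncomputable def eulerLogDeriv (F : K⟦X⟧) : K⟦X⟧ :=
  PowerSeries.X * PowerSeries.derivative K F * F⁻¹

theorem mul_eulerLogDeriv {F : K⟦X⟧} (hF : PowerSeries.constantCoeff F ≠ 0) :
    F * eulerLogDeriv F = PowerSeries.X * PowerSeries.derivative K F := by
  rw [eulerLogDeriv, mul_left_comm, PowerSeries.mul_inv_cancel F hF, mul_one]

theorem eulerLogDeriv_one : eulerLogDeriv (1 : K⟦X⟧) = 0 := by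
  rw [eulerLogDeriv, PowerSeries.derivative_one, mul_zero, zero_mul]

theorem eulerLogDeriv_mul {F G : K⟦X⟧} (hF : PowerSeries.constantCoeff F ≠ 0)
    (hG : PowerSeries.constantCoeff G ≠ 0) :
    eulerLogDeriv (F * G) = eulerLogDeriv F + eulerLogDeriv G := by
  have hFG : PowerSeries.constantCoeff (F * G) ≠ 0 := by
    rw [map_mul]
    exact mul_ne_zero hF hG
  have hne : F * G ≠ 0 := fun h => hFG (by rw [h, map_zero])
  refine mul_left_cancel₀ hne ?_
  rw [mul_eulerLogDeriv hFG, Derivation.leibniz, smul_eq_mul, smul_eq_mul]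
  linear_combination (-G) * mul_eulerLogDeriv hF - F * mul_eulerLogDeriv hG

theorem mul_coeff_eq_sum_coeff_mul_coeff_eulerLogDeriv {F : K⟦X⟧}
    (hF : PowerSeries.constantCoeff F ≠ 0) (r : ℕ) :
    r * PowerSeries.coeff r F
      = ∑ i : Fin r, PowerSeries.coeff i F * PowerSeries.coeff (r - i) (eulerLogDeriv F) := by
  have hzero : PowerSeries.coeff 0 (eulerLogDeriv F) = 0 := by
    rw [eulerLogDeriv, mul_assoc, PowerSeries.coeff_zero_X_mul]
  rw [← coeff_X_mul_derivative, ← mul_eulerLogDeriv hF, PowerSeries.coeff_mul,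
    Nat.sum_antidiagonal_eq_sum_range_succ
      (fun i j => PowerSeries.coeff i F * PowerSeries.coeff j (eulerLogDeriv F)),
    sum_range_succ, Nat.sub_self, hzero, mul_zero, add_zero, sum_range]

/-- Newton's recursion `r Z_r = ∑ i < r, Z_i L_{r - i}` expresses the coefficients of `Z` through
those of `L = X Z' / Z`, so polynomiality passes from `L` to `Z`. -/
theorem exists_polynomial_coeff_of_eulerLogDeriv [CharZero K] (ψ : ℕ → K[X]) (r : ℕ) :
    ∃ φ : K[X], ∀ (Z : K⟦X⟧) (a : K), PowerSeries.constantCoeff Z = 1 →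
      (∀ j ≤ r, PowerSeries.coeff j (eulerLogDeriv Z) = (ψ j).eval a) →
      PowerSeries.coeff r Z = φ.eval a := by
  induction r using Nat.strong_induction_on with
  | _ r ih =>
    rcases r.eq_zero_or_pos with rfl | hr
    · exact ⟨1, fun Z a hZ _ => by
        rw [PowerSeries.coeff_zero_eq_constantCoeff_apply, hZ, eval_one]⟩
    choose! φ hφ using ih
    refine ⟨C (r : K)⁻¹ * ∑ i : Fin r, φ i * ψ (r - i), fun Z a hZ hL => ?_⟩
    have hr0 : (r : K) ≠ 0 := Nat.cast_ne_zero.2 hr.ne'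
    rw [eval_mul, eval_C, eq_inv_mul_iff_mul_eq₀ hr0,
      mul_coeff_eq_sum_coeff_mul_coeff_eulerLogDeriv (hZ ▸ one_ne_zero), eval_finsetSum]
    refine sum_congr rfl fun i _ => ?_
    rw [eval_mul, hφ i i.2 Z a hZ fun j hj => hL j (hj.trans i.2.le), hL _ (Nat.sub_le r i)]

end EulerLogDeriv

section RankSeries

variable {E : Type*}

/-- The rank generating series `∑ A ⊆ B, (-1)^|A| X^(ρ A)` of a set function `ρ`. For the rank
function of a graph it is the chromatic polynomial with its coefficients in reverse order. -/
noncomputable def rankSeries (ρ : Finset E → ℕ) (B : Finset E) : ℚ⟦X⟧ :=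
  ∑ A ∈ B.powerset, PowerSeries.monomial (ρ A) ((-1) ^ #A)

theorem coeff_rankSeries (ρ : Finset E → ℕ) (B : Finset E) (r : ℕ) :
    PowerSeries.coeff r (rankSeries ρ B) = ∑ A ∈ B.powerset, if r = ρ A then (-1) ^ #A else 0 := by
  simp only [rankSeries, map_sum, PowerSeries.coeff_monomial]

theorem constantCoeff_rankSeries {ρ : Finset E → ℕ} (hρ : ∀ A, ρ A = 0 ↔ A = ∅) (B : Finset E) :
    PowerSeries.constantCoeff (rankSeries ρ B) = 1 := by
  rw [← PowerSeries.coeff_zero_eq_constantCoeff_apply, coeff_rankSeries,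
    sum_eq_single_of_mem ∅ (empty_mem_powerset B)
      fun A _ hA => if_neg fun h => hA ((hρ A).1 h.symm),
    if_pos ((hρ ∅).2 rfl).symm, card_empty, pow_zero]

theorem X_mul_derivative_rankSeries (ρ : Finset E → ℕ) (B : Finset E) :
    PowerSeries.X * PowerSeries.derivative ℚ (rankSeries ρ B)
      = ∑ A ∈ B.powerset, PowerSeries.monomial (ρ A) ((ρ A : ℚ) * (-1) ^ #A) := by
  ext r
  simp only [coeff_X_mul_derivative, coeff_rankSeries, map_sum, PowerSeries.coeff_monomial,
    mul_sum]
  refine sum_congr rfl fun A _ => ?_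
  split_ifs with h
  · rw [h]
  · rw [mul_zero]

theorem X_pow_dvd_monomial {R : Type*} [Semiring R] (n : ℕ) (a : R) :
    (PowerSeries.X : R⟦X⟧) ^ n ∣ PowerSeries.monomial n a :=
  PowerSeries.X_pow_dvd_iff.2 fun m hm => by rw [PowerSeries.coeff_monomial, if_neg hm.ne]

theorem rankSeries_image {E' : Type*} [DecidableEq E'] {ρ : Finset E → ℕ} {ρ' : Finset E' → ℕ}
    {f : E → E'} {B : Finset E} (hf : Set.InjOn f B) (hρ : ∀ A ⊆ B, ρ' (A.image f) = ρ A) :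
    rankSeries ρ' (B.image f) = rankSeries ρ B := by
  classical
  rw [rankSeries, rankSeries, powerset_image, sum_image (image_injOn_powerset_of_injOn hf)]
  refine sum_congr rfl fun A hA => ?_
  rw [mem_powerset] at hA
  rw [hρ A hA, card_image_of_injOn (hf.mono hA)]

theorem rankSeries_eq_mul_of_additive {ρ : Finset E → ℕ} (p : E → Prop) [DecidablePred p]
    {B : Finset E} (hρ : ∀ A ⊆ B, ρ A = ρ {e ∈ A | p e} + ρ {e ∈ A | ¬ p e}) :
    rankSeries ρ B = rankSeries ρ {e ∈ B | p e} * rankSeries ρ {e ∈ B | ¬ p e} := by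
  classical
  simp only [rankSeries]
  rw [sum_mul_sum, ← sum_product']
  refine sum_bij' (fun A _ => ({e ∈ A | p e}, {e ∈ A | ¬ p e})) (fun P _ => P.1 ∪ P.2)
    (fun A hA => ?_) (fun P hP => ?_) (fun A _ => filter_union_filter_not_eq p A)
    (fun P hP => ?_) (fun A hA => ?_)
  · rw [mem_product, mem_powerset, mem_powerset]
    exact ⟨filter_subset_filter _ (mem_powerset.1 hA), filter_subset_filter _ (mem_powerset.1 hA)⟩
  · rw [mem_product, mem_powerset, mem_powerset] at hP
    exact mem_powerset.2 (union_subset (hP.1.trans (filter_subset _ _))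
      (hP.2.trans (filter_subset _ _)))
  · rw [mem_product, mem_powerset, mem_powerset] at hP
    have h1 : ∀ e ∈ P.1, p e := fun e he => (mem_filter.1 (hP.1 he)).2
    have h2 : ∀ e ∈ P.2, ¬ p e := fun e he => (mem_filter.1 (hP.2 he)).2
    ext e <;> simp only [mem_filter, mem_union] <;> grind
  · rw [PowerSeries.monomial_mul_monomial, ← pow_add, card_filter_add_card_filter_not,
      ← hρ A (mem_powerset.1 hA)]

variable [DecidableEq E]

/-- The Möbius transform of the logarithmic Euler derivative of the rank series. With the logarithm
itself it would be the truncated weight in the cluster expansion of statistical mechanics. -/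
noncomputable def clusterWeight (ρ : Finset E → ℕ) : Finset E → ℚ⟦X⟧ :=
  moebiusTransform fun A => eulerLogDeriv (rankSeries ρ A)

theorem sum_powerset_clusterWeight (ρ : Finset E → ℕ) (B : Finset E) :
    ∑ A ∈ B.powerset, clusterWeight ρ A = eulerLogDeriv (rankSeries ρ B) :=
  sum_powerset_moebiusTransform _ B

theorem clusterWeight_empty {ρ : Finset E → ℕ} (hρ : ρ ∅ = 0) : clusterWeight ρ ∅ = 0 := by
  have h1 : rankSeries ρ ∅ = 1 := by simp [rankSeries, hρ, PowerSeries.monomial_zero_eq_C_apply]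
  rw [clusterWeight, moebiusTransform_empty, h1, eulerLogDeriv_one]

theorem clusterWeight_image {E' : Type*} [DecidableEq E'] {ρ : Finset E → ℕ}
    {ρ' : Finset E' → ℕ} {f : E → E'} {B : Finset E} (hf : Set.InjOn f B)
    (hρ : ∀ A ⊆ B, ρ' (A.image f) = ρ A) :
    clusterWeight ρ' (B.image f) = clusterWeight ρ B :=
  moebiusTransform_image hf fun A hA => by
    rw [rankSeries_image (hf.mono hA) fun C hC => hρ C (hC.trans hA)]

theorem clusterWeight_eq_zero_of_additive {ρ : Finset E → ℕ} (hρ0 : ∀ A, ρ A = 0 ↔ A = ∅)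
    (p : E → Prop) [DecidablePred p] {B : Finset E}
    (hρ : ∀ A ⊆ B, ρ A = ρ {e ∈ A | p e} + ρ {e ∈ A | ¬ p e})
    (hp : ∃ e ∈ B, p e) (hnp : ∃ e ∈ B, ¬ p e) : clusterWeight ρ B = 0 := by
  have hcoeff : ∀ A, PowerSeries.constantCoeff (rankSeries ρ A) ≠ 0 := fun A => by
    rw [constantCoeff_rankSeries hρ0]
    exact one_ne_zero
  refine moebiusTransform_eq_zero_of_additive p (fun A hA => ?_) hp hnp
  rw [rankSeries_eq_mul_of_additive p fun C hC => hρ C (hC.trans hA),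
    eulerLogDeriv_mul (hcoeff _) (hcoeff _)]

theorem X_pow_dvd_clusterWeight {ρ : Finset E → ℕ} (hρ0 : ∀ A, ρ A = 0 ↔ A = ∅)
    (hρ : ∀ A B, ρ (A ∪ B) ≤ ρ A + ρ B) (B : Finset E) :
    PowerSeries.X ^ ρ B ∣ clusterWeight ρ B := by
  have hcoeff : ∀ A, PowerSeries.constantCoeff (rankSeries ρ A) = 1 := constantCoeff_rankSeries hρ0
  refine pow_dvd_moebiusTransform_of_mul hρ (F := rankSeries ρ) (fun A => ?_) (fun A => ?_)
    (fun A => ?_) B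
  · exact PowerSeries.isUnit_iff_constantCoeff.2 (hcoeff A ▸ isUnit_one)
  · unfold rankSeries
    rw [moebiusTransform_sum_powerset]
    exact X_pow_dvd_monomial _ _
  · simp_rw [fun A => mul_eulerLogDeriv (F := rankSeries ρ A) (hcoeff A ▸ one_ne_zero),
      X_mul_derivative_rankSeries]
    rw [moebiusTransform_sum_powerset]
    exact X_pow_dvd_monomial _ _

end RankSeries

/-- An oriented multigraph with edges `E` and vertices `V`. The orientation is auxiliary: no notion
below depends on it, except that a homomorphism is required to respect it. -/
structure Multigraph (E V : Type*) where
  src : E → V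
  tgt : E → V

namespace Multigraph

section Rank

variable {E V : Type*} (G : Multigraph E V)

/-- The row of the oriented incidence matrix that belongs to the edge `e`. -/
noncomputable def edgeVector (e : E) : V →₀ ℚ :=
  Finsupp.single (G.src e) 1 - Finsupp.single (G.tgt e) 1

/-- The row space of the oriented incidence matrix of the edge set `A`. -/
noncomputable def edgeSpan (A : Finset E) : Submodule ℚ (V →₀ ℚ) :=
  Submodule.span ℚ (G.edgeVector '' A)

/-- The rank of an edge set in the graphic matroid. -/
noncomputable def rank (A : Finset E) : ℕ :=
  Module.finrank ℚ (G.edgeSpan A)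

/-- The vertices that are incident to an edge of `A`. -/
def vertices (A : Finset E) : Set V :=
  {v | ∃ e ∈ A, G.src e = v ∨ G.tgt e = v}

/-- No edge has equal endpoints. -/
def Loopless : Prop :=
  ∀ e, G.src e ≠ G.tgt e

/-- The edge set `A` is nonempty and connected: a property of vertices that is invariant along the
edges of `A` holds at all vertices of `A` or at none. -/
structure Connected (A : Finset E) : Prop where
  nonempty : A.Nonempty
  induction (p : V → Prop) (hp : ∀ e ∈ A, p (G.src e) ↔ p (G.tgt e)) {x y : V}
    (hx : x ∈ G.vertices A) (hy : y ∈ G.vertices A) : p x → p y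

variable {G} {A : Finset E} {e : E}

instance finiteDimensional_edgeSpan : FiniteDimensional ℚ (G.edgeSpan A) :=
  FiniteDimensional.span_of_finite ℚ (A.finite_toSet.image _)

theorem edgeVector_mem_edgeSpan (he : e ∈ A) : G.edgeVector e ∈ G.edgeSpan A :=
  Submodule.subset_span ⟨e, he, rfl⟩

theorem src_mem_vertices (he : e ∈ A) : G.src e ∈ G.vertices A :=
  ⟨e, he, Or.inl rfl⟩

theorem tgt_mem_vertices (he : e ∈ A) : G.tgt e ∈ G.vertices A :=
  ⟨e, he, Or.inr rfl⟩

theorem vertices_mono {A B : Finset E} (h : A ⊆ B) : G.vertices A ⊆ G.vertices B :=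
  fun _ ⟨e, he, hv⟩ => ⟨e, h he, hv⟩

theorem finite_vertices : (G.vertices A).Finite := by
  refine ((A.finite_toSet.image G.src).union (A.finite_toSet.image G.tgt)).subset ?_
  rintro _ ⟨e, he, rfl | rfl⟩
  exacts [Or.inl ⟨e, he, rfl⟩, Or.inr ⟨e, he, rfl⟩]

theorem Connected.nonempty_vertices (hA : G.Connected A) : (G.vertices A).Nonempty :=
  hA.nonempty.imp' G.src fun _ => src_mem_vertices

theorem edgeSpan_union [DecidableEq E] (A B : Finset E) :
    G.edgeSpan (A ∪ B) = G.edgeSpan A ⊔ G.edgeSpan B := by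
  rw [edgeSpan, coe_union, Set.image_union, Submodule.span_union, edgeSpan, edgeSpan]

theorem rank_union_le [DecidableEq E] (A B : Finset E) : G.rank (A ∪ B) ≤ G.rank A + G.rank B := by
  rw [rank, edgeSpan_union]
  exact Submodule.finrank_add_le_finrank_add_finrank _ _

theorem rank_empty : G.rank ∅ = 0 := by
  rw [rank, edgeSpan, coe_empty, Set.image_empty, Submodule.span_empty, finrank_bot]

theorem Loopless.rank_eq_zero_iff (hG : G.Loopless) (A : Finset E) : G.rank A = 0 ↔ A = ∅ := by
  refine ⟨fun h => eq_empty_of_forall_notMem fun e he => hG e ?_, fun h => h ▸ rank_empty⟩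
  have hzero := edgeVector_mem_edgeSpan (G := G) he
  rw [rank, Submodule.finrank_eq_zero] at h
  rw [h, Submodule.mem_bot, edgeVector, sub_eq_zero] at hzero
  exact Finsupp.single_left_injective one_ne_zero hzero

theorem edgeSpan_le_supported : G.edgeSpan A ≤ Finsupp.supported ℚ ℚ (G.vertices A) := by
  rw [edgeSpan, Submodule.span_le]
  rintro _ ⟨e, he, rfl⟩
  exact Submodule.sub_mem _ (Finsupp.single_mem_supported ℚ _ (src_mem_vertices he))
    (Finsupp.single_mem_supported ℚ _ (tgt_mem_vertices he))

theorem rank_union_of_disjoint_vertices [DecidableEq E] {A B : Finset E}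
    (h : Disjoint (G.vertices A) (G.vertices B)) : G.rank (A ∪ B) = G.rank A + G.rank B := by
  have hdisj : Disjoint (G.edgeSpan A) (G.edgeSpan B) :=
    (Finsupp.disjoint_supported_supported h).mono edgeSpan_le_supported edgeSpan_le_supported
  rw [rank, edgeSpan_union, rank, rank, ← Submodule.finrank_sup_add_finrank_inf_eq, hdisj.eq_bot,
    finrank_bot, add_zero]

theorem rank_eq_add_of_invariant (p : V → Prop) [DecidablePred p]
    (hp : ∀ e ∈ A, p (G.src e) ↔ p (G.tgt e)) :
    G.rank A = G.rank {e ∈ A | p (G.src e)} + G.rank {e ∈ A | ¬ p (G.src e)} := by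
  classical
  rw [← rank_union_of_disjoint_vertices, filter_union_filter_not_eq]
  rw [Set.disjoint_left]
  rintro v ⟨e, he, hev⟩ ⟨d, hd, hdv⟩
  rw [mem_filter] at he hd
  have hv : p v := hev.elim (fun h => h ▸ he.2) fun h => h ▸ (hp e he.1).1 he.2
  exact hd.2 (hdv.elim (fun h => h ▸ hv) fun h => (hp d hd.1).2 (h ▸ hv))

theorem Connected.span_single_le (hA : G.Connected A) {x : V} (hx : x ∈ G.vertices A) :
    Submodule.span ℚ ((fun v => Finsupp.single v (1 : ℚ)) '' G.vertices A)
      ≤ G.edgeSpan A ⊔ Submodule.span ℚ {Finsupp.single x 1} := by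
  rw [Submodule.span_le]
  rintro _ ⟨y, hy, rfl⟩
  refine hA.induction (fun v => Finsupp.single v (1 : ℚ) ∈ G.edgeSpan A ⊔ Submodule.span ℚ _)
    (fun e he => ?_) hx hy (Submodule.mem_sup_right (Submodule.mem_span_singleton_self _))
  rw [← sub_add_cancel (Finsupp.single (G.src e) 1) (Finsupp.single (G.tgt e) 1)]
  exact Submodule.add_mem_iff_right _ (Submodule.mem_sup_left (edgeVector_mem_edgeSpan he))

theorem Connected.ncard_vertices_le (hA : G.Connected A) :
    (G.vertices A).ncard ≤ G.rank A + 1 := by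
  obtain ⟨x, hx⟩ := hA.nonempty_vertices
  have := finite_vertices (G := G) (A := A).fintype
  have hli : LinearIndependent ℚ fun v : G.vertices A => Finsupp.single (v : V) (1 : ℚ) :=
    (Finsupp.linearIndependent_single_one ℚ V).comp _ Subtype.val_injective
  calc (G.vertices A).ncard
      = Module.finrank ℚ (Submodule.span ℚ
          ((fun v => Finsupp.single v (1 : ℚ)) '' G.vertices A)) := by
        rw [Set.image_eq_range, finrank_span_eq_card hli, Set.ncard_eq_toFinset_card',
          Set.toFinset_card]
    _ ≤ Module.finrank ℚ
          ↥(G.edgeSpan A ⊔ Submodule.span ℚ {Finsupp.single x (1 : ℚ)}) :=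
        Submodule.finrank_mono (hA.span_single_le hx)
    _ ≤ G.rank A + Module.finrank ℚ (Submodule.span ℚ {Finsupp.single x (1 : ℚ)}) :=
        Submodule.finrank_add_le_finrank_add_finrank _ _
    _ = G.rank A + 1 := by
        rw [finrank_span_singleton (Finsupp.single_ne_zero.2 one_ne_zero)]

theorem Connected.ncard_image_vertices_le (hA : G.Connected A) {X : Type*} (f : V → X) :
    (f '' G.vertices A).ncard ≤ G.rank A + 1 :=
  (Set.ncard_image_le finite_vertices).trans hA.ncard_vertices_le

theorem Loopless.clusterWeight_eq_zero [DecidableEq E] (hG : G.Loopless) (hA : ¬ G.Connected A) :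
    clusterWeight G.rank A = 0 := by
  classical
  rcases A.eq_empty_or_nonempty with rfl | hne
  · exact clusterWeight_empty rank_empty
  obtain ⟨p, hp, x, hx, y, hy, hpx, hpy⟩ : ∃ p : V → Prop, (∀ e ∈ A, p (G.src e) ↔ p (G.tgt e)) ∧
      ∃ x ∈ G.vertices A, ∃ y ∈ G.vertices A, p x ∧ ¬ p y := by
    by_contra! h
    exact hA ⟨hne, fun p hp x y hx hy => h p hp x hx y hy⟩
  obtain ⟨e, he, hex⟩ := hx
  obtain ⟨d, hd, hdy⟩ := hy
  exact clusterWeight_eq_zero_of_additive hG.rank_eq_zero_iff (fun e => p (G.src e))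
    (fun B hB => rank_eq_add_of_invariant p fun e he => hp e (hB he))
    ⟨e, he, hex.elim (fun h => h ▸ hpx) fun h => (hp e he).2 (h ▸ hpx)⟩
    ⟨d, hd, hdy.elim (fun h => h ▸ hpy) fun h => (hp d hd).not.2 (h ▸ hpy)⟩

open Classical in
theorem Loopless.coeff_eulerLogDeriv [DecidableEq E] (hG : G.Loopless) (B : Finset E) (j : ℕ) :
    PowerSeries.coeff j (eulerLogDeriv (rankSeries G.rank B))
      = ∑ A ∈ B.powerset with G.Connected A ∧ G.rank A ≤ j,
        PowerSeries.coeff j (clusterWeight G.rank A) := by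
  rw [← sum_powerset_clusterWeight, map_sum]
  refine (sum_filter_of_ne fun A _ hne => ⟨?_, ?_⟩).symm
  · by_contra hA
    exact hne (by rw [hG.clusterWeight_eq_zero hA, map_zero])
  · by_contra! hj
    exact hne (PowerSeries.X_pow_dvd_iff.1
      (X_pow_dvd_clusterWeight hG.rank_eq_zero_iff rank_union_le A) j hj)

end Rank

section Hom

variable {E V E' V' : Type*}

/-- The maps `fE` on edges and `fV` on vertices send the edges of `A` in `G` to edges of `H`. -/
def IsHomOn (G : Multigraph E V) (H : Multigraph E' V') (fE : E → E') (fV : V → V')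
    (A : Finset E) : Prop :=
  ∀ e ∈ A, H.src (fE e) = fV (G.src e) ∧ H.tgt (fE e) = fV (G.tgt e)

variable {G : Multigraph E V} {H : Multigraph E' V'} {fE : E → E'} {fV : V → V'}
  {gE : E' → E} {gV : V' → V} {A : Finset E}

theorem IsHomOn.mono {B : Finset E} (h : IsHomOn G H fE fV B) (hAB : A ⊆ B) :
    IsHomOn G H fE fV A :=
  fun e he => h e (hAB he)

variable [DecidableEq E']

theorem IsHomOn.vertices_image (h : IsHomOn G H fE fV A) :
    H.vertices (A.image fE) = fV '' G.vertices A := by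
  ext v
  constructor
  · rintro ⟨_, hmem, hv⟩
    obtain ⟨e, he, rfl⟩ := mem_image.1 hmem
    rw [(h e he).1, (h e he).2] at hv
    exact hv.elim (fun hv => ⟨_, src_mem_vertices he, hv⟩) fun hv => ⟨_, tgt_mem_vertices he, hv⟩
  · rintro ⟨_, ⟨e, he, rfl | rfl⟩, rfl⟩
    · exact (h e he).1 ▸ src_mem_vertices (mem_image_of_mem fE he)
    · exact (h e he).2 ▸ tgt_mem_vertices (mem_image_of_mem fE he)

theorem IsHomOn.edgeSpan_image (h : IsHomOn G H fE fV A) :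
    H.edgeSpan (A.image fE) = (G.edgeSpan A).map (Finsupp.lmapDomain ℚ ℚ fV) := by
  rw [edgeSpan, edgeSpan, Submodule.map_span, coe_image, Set.image_image, Set.image_image]
  congr 1
  refine Set.image_congr fun e he => ?_
  rw [edgeVector, edgeVector, map_sub, Finsupp.lmapDomain_apply, Finsupp.lmapDomain_apply,
    Finsupp.mapDomain_single, Finsupp.mapDomain_single, (h e he).1, (h e he).2]

theorem IsHomOn.rank_image_le (h : IsHomOn G H fE fV A) : H.rank (A.image fE) ≤ G.rank A := by
  rw [rank, rank, h.edgeSpan_image]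
  exact Submodule.finrank_map_le _ _

theorem IsHomOn.connected_image (h : IsHomOn G H fE fV A) (hA : G.Connected A) :
    H.Connected (A.image fE) := by
  refine ⟨hA.nonempty.image fE, fun p hp {x y} hx hy => ?_⟩
  rw [h.vertices_image] at hx hy
  obtain ⟨x, hx, rfl⟩ := hx
  obtain ⟨y, hy, rfl⟩ := hy
  refine hA.induction (fun v => p (fV v)) (fun e he => ?_) hx hy
  rw [← (h e he).1, ← (h e he).2]
  exact hp _ (mem_image_of_mem fE he)

theorem IsHomOn.of_leftInvOn (h : IsHomOn G H fE fV A) (hE : Set.LeftInvOn gE fE A)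
    (hV : Set.LeftInvOn gV fV (G.vertices A)) : IsHomOn H G gE gV (A.image fE) := by
  refine forall_mem_image.2 fun e he => ?_
  rw [hE he, (h e he).1, (h e he).2, hV (src_mem_vertices he), hV (tgt_mem_vertices he)]
  exact ⟨rfl, rfl⟩

theorem image_image_of_leftInvOn [DecidableEq E] (hE : Set.LeftInvOn gE fE A) :
    (A.image fE).image gE = A := by
  rw [← coe_inj, coe_image, coe_image, hE.image_image]

theorem IsHomOn.rank_image (h : IsHomOn G H fE fV A) (hE : Set.LeftInvOn gE fE A)
    (hV : Set.LeftInvOn gV fV (G.vertices A)) : H.rank (A.image fE) = G.rank A := by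
  classical
  refine h.rank_image_le.antisymm ?_
  conv_lhs => rw [← image_image_of_leftInvOn hE]
  exact (h.of_leftInvOn hE hV).rank_image_le

theorem IsHomOn.clusterWeight_image [DecidableEq E] (h : IsHomOn G H fE fV A)
    (hE : Set.LeftInvOn gE fE A) (hV : Set.LeftInvOn gV fV (G.vertices A)) :
    clusterWeight H.rank (A.image fE) = clusterWeight G.rank A :=
  _root_.clusterWeight_image hE.injOn fun _ hC =>
    (h.mono hC).rank_image (hE.mono hC) (hV.mono (vertices_mono hC))

end Hom

section Components

variable {E V : Type*} (G : Multigraph E V)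

/-- The connected components of the spanning subgraph with edge set `A`, including the isolated
vertices. -/
abbrev Component (A : Finset E) : Type _ :=
  Quot fun u v => ∃ e ∈ A, G.src e = u ∧ G.tgt e = v

variable {A : Finset E}

theorem Component.mk_src_eq_mk_tgt {e : E} (he : e ∈ A) :
    (Quot.mk _ (G.src e) : G.Component A) = Quot.mk _ (G.tgt e) :=
  Quot.sound ⟨e, he, rfl, rfl⟩

theorem ker_lmapDomain_mk_component :
    LinearMap.ker (Finsupp.lmapDomain ℚ ℚ (Quot.mk _ : V → G.Component A)) = G.edgeSpan A := by
  apply le_antisymm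
  · let σ : (G.Component A →₀ ℚ) →ₗ[ℚ] (V →₀ ℚ) ⧸ G.edgeSpan A :=
      Finsupp.linearCombination ℚ <|
        Quot.lift (fun v => (G.edgeSpan A).mkQ (Finsupp.single v 1)) <| by
          rintro _ _ ⟨e, he, rfl, rfl⟩
          exact (Submodule.Quotient.eq _).2 (edgeVector_mem_edgeSpan he)
    have hσ : σ ∘ₗ Finsupp.lmapDomain ℚ ℚ (Quot.mk _) = (G.edgeSpan A).mkQ := by
      ext v
      simp [σ]
    rw [← Submodule.ker_mkQ (G.edgeSpan A), ← hσ]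
    exact LinearMap.ker_le_ker_comp _ _
  · rw [edgeSpan, Submodule.span_le]
    rintro _ ⟨e, he, rfl⟩
    rw [SetLike.mem_coe, LinearMap.mem_ker, edgeVector, map_sub, Finsupp.lmapDomain_apply,
      Finsupp.lmapDomain_apply, Finsupp.mapDomain_single, Finsupp.mapDomain_single,
      Component.mk_src_eq_mk_tgt G he, sub_self]

variable [Finite V]

theorem card_component_add_rank : Nat.card (G.Component A) + G.rank A = Nat.card V := by
  have := Fintype.ofFinite V
  have := Fintype.ofFinite (G.Component A)
  have hsurj : Function.Surjective
      (Finsupp.lmapDomain ℚ ℚ (Quot.mk _ : V → G.Component A)) :=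
    Finsupp.mapDomain_surjective Quot.mk_surjective
  have hdim := LinearMap.finrank_range_add_finrank_ker
    (Finsupp.lmapDomain ℚ ℚ (Quot.mk _ : V → G.Component A))
  rwa [LinearMap.range_eq_top.2 hsurj, finrank_top, ker_lmapDomain_mk_component,
    Module.finrank_finsupp_self, Module.finrank_finsupp_self, ← Nat.card_eq_fintype_card,
    ← Nat.card_eq_fintype_card] at hdim

theorem rank_le_card (A : Finset E) : G.rank A ≤ Nat.card V :=
  (G.card_component_add_rank (A := A)) ▸ Nat.le_add_left _ _

theorem card_colorings_constant_along (A : Finset E) (n : ℕ) :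
    Nat.card {c : V → Fin n // ∀ e ∈ A, c (G.src e) = c (G.tgt e)}
      = n ^ (Nat.card V - G.rank A) := by
  have hlift : {c : V → Fin n // ∀ e ∈ A, c (G.src e) = c (G.tgt e)}
      ≃ (G.Component A → Fin n) :=
    { toFun := fun c => Quot.lift c.1 <| by
        rintro _ _ ⟨e, he, rfl, rfl⟩
        exact c.2 e he
      invFun := fun f => ⟨fun v => f (Quot.mk _ v), fun _ he =>
        congrArg f (Component.mk_src_eq_mk_tgt G he)⟩
      left_inv := fun _ => rfl
      right_inv := fun _ => funext <| Quot.ind fun _ => rfl }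
  rw [Nat.card_congr hlift, Nat.card_fun, Nat.card_fin, ← G.card_component_add_rank (A := A),
    Nat.add_sub_cancel]

end Components

section ChromaticPolynomial

variable {E V : Type*}

/-- The simple graph obtained by forgetting orientations and multiplicities and deleting loops. -/
def toSimpleGraph (G : Multigraph E V) : SimpleGraph V :=
  SimpleGraph.fromRel fun u v => ∃ e, G.src e = u ∧ G.tgt e = v

variable {G : Multigraph E V}

/-- Proper colorings of a graph as functions on vertices. -/
def Loopless.coloringEquiv (hG : G.Loopless) (α : Type*) :
    G.toSimpleGraph.Coloring α ≃ {c : V → α // ∀ e, c (G.src e) ≠ c (G.tgt e)} where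
  toFun c := ⟨c, fun e => c.valid ⟨hG e, Or.inl ⟨e, rfl, rfl⟩⟩⟩
  invFun c := SimpleGraph.Coloring.mk c.1 <| by
    rintro u v ⟨-, ⟨e, rfl, rfl⟩ | ⟨e, rfl, rfl⟩⟩
    exacts [c.2 e, (c.2 e).symm]
  left_inv _ := rfl
  right_inv _ := rfl

variable [Finite V]

/-- Inclusion–exclusion over the set of edges with equally colored endpoints. -/
theorem Loopless.card_coloring [Fintype E] (hG : G.Loopless) (n : ℕ) :
    (Nat.card (G.toSimpleGraph.Coloring (Fin n)) : ℤ)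
      = ∑ A : Finset E, (-1) ^ #A * (n : ℤ) ^ (Nat.card V - G.rank A) := by
  classical
  have := Fintype.ofFinite V
  let monochromatic (e : E) : Finset (V → Fin n) := {c | c (G.src e) = c (G.tgt e)}
  have hproper : univ.inf (fun e => (monochromatic e)ᶜ)
      = ({c | ∀ e, c (G.src e) ≠ c (G.tgt e)} : Finset (V → Fin n)) := by
    ext c
    simp [monochromatic, mem_inf]
  have hconstant (A : Finset E) : A.inf monochromatic
      = ({c | ∀ e ∈ A, c (G.src e) = c (G.tgt e)} : Finset (V → Fin n)) := by
    ext c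
    simp [monochromatic, mem_inf]
  rw [Nat.card_congr (hG.coloringEquiv _), Nat.card_eq_fintype_card, Fintype.card_subtype,
    ← hproper, inclusion_exclusion_card_inf_compl, powerset_univ]
  refine sum_congr rfl fun A _ => ?_
  rw [hconstant, ← Fintype.card_subtype, ← Nat.card_eq_fintype_card,
    card_colorings_constant_along, Nat.cast_pow]

theorem Loopless.chromaticPolynomial_eq [Fintype E] (hG : G.Loopless) :
    G.toSimpleGraph.chromaticPolynomial
      = ∑ A : Finset E, monomial (Nat.card V - G.rank A) ((-1 : ℚ) ^ #A) := by
  refine G.toSimpleGraph.existsUnique_chromaticPolynomial.unique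
    G.toSimpleGraph.chromaticPolynomial_eval fun n => ?_
  have hcard := congrArg (Int.cast : ℤ → ℚ) (hG.card_coloring n)
  push_cast at hcard
  simp only [hcard, eval_finsetSum, eval_monomial]

theorem Loopless.coeff_chromaticPolynomial [Fintype E] (hG : G.Loopless) {r : ℕ}
    (hr : r ≤ Nat.card V) :
    G.toSimpleGraph.chromaticPolynomial.coeff (Nat.card V - r)
      = PowerSeries.coeff r (rankSeries G.rank univ) := by
  rw [hG.chromaticPolynomial_eq, coeff_rankSeries, finsetSum_coeff, powerset_univ]
  refine sum_congr rfl fun A _ => ?_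
  have hA : Nat.card V - G.rank A = Nat.card V - r ↔ r = G.rank A := by
    have := G.rank_le_card A
    omega
  simp only [coeff_monomial, hA]

theorem Loopless.coeff_card_chromaticPolynomial [Finite E] (hG : G.Loopless) :
    G.toSimpleGraph.chromaticPolynomial.coeff (Nat.card V) = 1 := by
  have := Fintype.ofFinite E
  have hcoeff := hG.coeff_chromaticPolynomial (Nat.zero_le _)
  rwa [Nat.sub_zero, PowerSeries.coeff_zero_eq_constantCoeff_apply,
    constantCoeff_rankSeries hG.rank_eq_zero_iff] at hcoeff

theorem Loopless.natDegree_chromaticPolynomial [Finite E] (hG : G.Loopless) :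
    G.toSimpleGraph.chromaticPolynomial.natDegree = Nat.card V := by
  have := Fintype.ofFinite E
  refine natDegree_eq_of_le_of_coeff_ne_zero ?_ (hG.coeff_card_chromaticPolynomial ▸ one_ne_zero)
  rw [hG.chromaticPolynomial_eq]
  exact natDegree_sum_le_of_forall_le _ _ fun A _ =>
    (natDegree_monomial_le _).trans (Nat.sub_le _ _)

theorem Loopless.chromaticPolynomial_monic [Finite E] (hG : G.Loopless) :
    G.toSimpleGraph.chromaticPolynomial.Monic := by
  rw [Monic, leadingCoeff, hG.natDegree_chromaticPolynomial, hG.coeff_card_chromaticPolynomial]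

theorem Loopless.codegreeCoeff_chromaticPolynomial [Fintype E] (hG : G.Loopless) (r : ℕ) :
    codegreeCoeff G.toSimpleGraph.chromaticPolynomial r
      = PowerSeries.coeff r (rankSeries G.rank univ) := by
  rw [codegreeCoeff, hG.natDegree_chromaticPolynomial]
  split_ifs with hr
  · exact hG.coeff_chromaticPolynomial hr
  · rw [coeff_rankSeries, sum_eq_zero]
    intro A _
    have hA := G.rank_le_card A
    rw [if_neg (by omega)]

end ChromaticPolynomial

section Lattice

/-- The Cayley graph of `ι → R` with respect to the unit vectors: the grid for `R = ℕ`, the torus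
for `R = Fin (n + 2)`. The edge `(x, i)` leads from `x` to the next point in direction `i`. -/
def lattice (R ι : Type*) [Add R] [Zero R] [One R] [DecidableEq ι] :
    Multigraph ((ι → R) × ι) (ι → R) where
  src := Prod.fst
  tgt e := e.1 + Pi.single e.2 1

variable {R ι : Type*} [DecidableEq ι]

theorem lattice_tgt_apply [AddMonoid R] [One R] (e : (ι → R) × ι) (i : ι) :
    (lattice R ι).tgt e i = if i = e.2 then e.1 i + 1 else e.1 i := by
  change (e.1 + Pi.single e.2 1 : ι → R) i = _
  rw [Pi.add_apply, Pi.single_apply]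
  split_ifs
  exacts [rfl, add_zero _]

theorem lattice_tgt_eq_iff [AddMonoid R] [One R] {x y : ι → R} {i : ι} :
    (lattice R ι).tgt (x, i) = y ↔ y i = x i + 1 ∧ ∀ j, j ≠ i → x j = y j := by
  simp only [funext_iff, lattice_tgt_apply]
  refine ⟨fun h => ⟨?_, fun j hj => ?_⟩, fun ⟨hi, h⟩ j => ?_⟩
  · rw [← h i, if_pos rfl]
  · rw [← h j, if_neg hj]
  · split_ifs with hj
    · rw [hj, hi]
    · exact h j hj

theorem loopless_lattice [AddMonoid R] [IsLeftCancelAdd R] [One R] [NeZero (1 : R)] :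
    (lattice R ι).Loopless := fun _ h =>
  one_ne_zero (Pi.single_eq_zero_iff.1 (left_eq_add.1 h))

theorem Connected.exists_apply_eq {B : Finset ((ι → ℕ) × ι)} (hB : (lattice ℕ ι).Connected B)
    {x y : ι → ℕ} (hx : x ∈ (lattice ℕ ι).vertices B) (hy : y ∈ (lattice ℕ ι).vertices B)
    {i : ι} {a : ℕ} (hxa : x i ≤ a) (hay : a ≤ y i) :
    ∃ z ∈ (lattice ℕ ι).vertices B, z i = a := by
  by_contra! h
  refine (hB.induction (fun z => z i < a) (fun e he => ?_) hx hy
    (lt_of_le_of_ne hxa (h x hx))).not_ge hay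
  have hsrc := h _ (src_mem_vertices he)
  have htgt := h _ (tgt_mem_vertices he)
  rw [lattice_tgt_apply] at htgt ⊢
  change e.1 i ≠ a at hsrc
  change e.1 i < a ↔ _
  split_ifs at htgt ⊢ <;> omega

theorem Connected.apply_le_rank {B : Finset ((ι → ℕ) × ι)} (hB : (lattice ℕ ι).Connected B)
    {x y : ι → ℕ} (hx : x ∈ (lattice ℕ ι).vertices B) (hy : y ∈ (lattice ℕ ι).vertices B)
    {i : ι} (hxi : x i = 0) : y i ≤ (lattice ℕ ι).rank B := by
  have hsub : Set.Iic (y i) ⊆ (fun z : ι → ℕ => z i) '' (lattice ℕ ι).vertices B := fun a ha =>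
    hB.exists_apply_eq hx hy (hxi ▸ a.zero_le) ha
  have hcard := (Set.ncard_le_ncard hsub (finite_vertices.image _)).trans
    (hB.ncard_image_vertices_le _)
  rwa [← coe_Iic, Set.ncard_coe_finset, Nat.card_Iic, Nat.add_le_add_iff_right] at hcard

/-- A connected edge set of rank at most `j` in the grid that touches every coordinate hyperplane:
a normal form of the connected edge sets up to translation. -/
structure IsRootedShape (j : ℕ) (B : Finset ((ι → ℕ) × ι)) : Prop where
  connected : (lattice ℕ ι).Connected B
  rank_le : (lattice ℕ ι).rank B ≤ j
  exists_zero (i : ι) : ∃ x ∈ (lattice ℕ ι).vertices B, x i = 0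

theorem IsRootedShape.apply_le {j : ℕ} {B : Finset ((ι → ℕ) × ι)} (hB : IsRootedShape j B)
    {x : ι → ℕ} (hx : x ∈ (lattice ℕ ι).vertices B) (i : ι) : x i ≤ j :=
  have ⟨_, hz, hzi⟩ := hB.exists_zero i
  (hB.connected.apply_le_rank hz hx hzi).trans hB.rank_le

theorem finite_isRootedShape [Finite ι] (j : ℕ) :
    {B : Finset ((ι → ℕ) × ι) | IsRootedShape j B}.Finite := by
  have := Fintype.ofFinite ι
  refine (Finset.finite_toSet (Iic (fun _ : ι => j) ×ˢ univ).powerset).subset fun B hB => ?_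
  refine mem_coe.2 (mem_powerset.2 fun e he => mem_product.2 ⟨mem_Iic.2 fun i => ?_, mem_univ _⟩)
  exact hB.apply_le (src_mem_vertices he) i

/-- The rooted shapes of rank at most `j`. -/
noncomputable def rootedShapes (ι : Type*) [DecidableEq ι] [Fintype ι] (j : ℕ) :
    Finset (Finset ((ι → ℕ) × ι)) :=
  (finite_isRootedShape j).toFinset

theorem mem_rootedShapes [Fintype ι] {j : ℕ} {B : Finset ((ι → ℕ) × ι)} :
    B ∈ rootedShapes ι j ↔ IsRootedShape j B :=
  Set.Finite.mem_toFinset _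

end Lattice

section Torus

open scoped Fin.CommRing

variable {ι : Type*} {n : ℕ}

/-- The covering map from the grid to the torus that sends the origin to `v`. -/
def wrapVertex (v : ι → Fin (n + 2)) (x : ι → ℕ) : ι → Fin (n + 2) :=
  fun i => v i + x i

/-- The effect of `wrapVertex` on edges. -/
def wrapEdge (v : ι → Fin (n + 2)) (e : (ι → ℕ) × ι) : (ι → Fin (n + 2)) × ι :=
  (wrapVertex v e.1, e.2)

/-- The section of `wrapVertex` with values in the box `[0, n + 1]^ι`. -/
def unwrapVertex (v x : ι → Fin (n + 2)) : ι → ℕ :=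
  fun i => (x i - v i).val

/-- The effect of `unwrapVertex` on edges. -/
def unwrapEdge (v : ι → Fin (n + 2)) (e : (ι → Fin (n + 2)) × ι) : (ι → ℕ) × ι :=
  (unwrapVertex v e.1, e.2)

theorem wrapVertex_unwrapVertex (v x : ι → Fin (n + 2)) : wrapVertex v (unwrapVertex v x) = x := by
  funext i
  rw [wrapVertex, unwrapVertex, Fin.cast_val_eq_self, add_sub_cancel]

theorem unwrapVertex_wrapVertex (v : ι → Fin (n + 2)) {x : ι → ℕ} (hx : ∀ i, x i ≤ n + 1) :
    unwrapVertex v (wrapVertex v x) = x := by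
  funext i
  rw [unwrapVertex, wrapVertex, add_sub_cancel_left, Fin.val_cast_of_lt (Nat.lt_succ_of_le (hx i))]

variable [DecidableEq ι]

/-- In every direction, the hyperplane through `v` meets `B` and the preceding one does not. Thus
`B` does not wrap around the torus, and it lifts to the grid with `v` over the origin. -/
def IsCorner (v : ι → Fin (n + 2)) (B : Finset ((ι → Fin (n + 2)) × ι)) : Prop :=
  ∀ i, (∃ x ∈ (lattice (Fin (n + 2)) ι).vertices B, x i = v i) ∧
    ∀ x ∈ (lattice (Fin (n + 2)) ι).vertices B, x i ≠ v i - 1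

theorem val_add_one_sub {a b : Fin (n + 2)} (h : a ≠ b - 1) :
    (a + 1 - b).val = (a - b).val + 1 := by
  have hlast : Fin.last (n + 1) = -1 := Fin.ext Fin.coe_neg_one.symm
  rw [add_sub_right_comm, Fin.val_add_one, if_neg]
  rwa [hlast, sub_eq_iff_eq_add, neg_add_eq_sub]

theorem exists_mem_sub_one_notMem {S : Set (Fin (n + 2))} (hne : S.Nonempty) (hS : S ≠ Set.univ) :
    ∃ a ∈ S, a - 1 ∉ S := by
  by_contra! h
  obtain ⟨a, ha⟩ := hne
  have hsub (m : ℕ) : a - m ∈ S := by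
    induction m with
    | zero => simpa only [Nat.cast_zero, sub_zero] using ha
    | succ m ih => simpa only [Nat.cast_succ, sub_sub] using h _ ih
  refine hS (Set.eq_univ_of_forall fun b => ?_)
  simpa only [Fin.cast_val_eq_self, sub_sub_cancel] using hsub (a - b).val

variable {B : Finset ((ι → Fin (n + 2)) × ι)} {v w : ι → Fin (n + 2)}

theorem Connected.exists_isCorner (hB : (lattice (Fin (n + 2)) ι).Connected B)
    (hrank : (lattice (Fin (n + 2)) ι).rank B ≤ n) : ∃ v, IsCorner v B := by
  have hcoord (i : ι) : ∃ a ∈ (fun x : ι → Fin (n + 2) => x i) '' (lattice _ ι).vertices B,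
      a - 1 ∉ (fun x : ι → Fin (n + 2) => x i) '' (lattice _ ι).vertices B := by
    refine exists_mem_sub_one_notMem (hB.nonempty_vertices.image _) fun huniv => ?_
    have hcard := hB.ncard_image_vertices_le fun x : ι → Fin (n + 2) => x i
    rw [huniv, Set.ncard_univ, Nat.card_fin] at hcard
    omega
  choose v hmem hnotMem using hcoord
  exact ⟨v, fun i => ⟨hmem i, fun x hx hxi => hnotMem i ⟨x, hx, hxi⟩⟩⟩

theorem IsCorner.unique (hB : (lattice (Fin (n + 2)) ι).Connected B) (hv : IsCorner v B)
    (hw : IsCorner w B) : v = w := by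
  by_contra hne
  obtain ⟨i, hi⟩ := Function.ne_iff.1 hne
  obtain ⟨⟨x, hx, hxi⟩, hv⟩ := hv i
  obtain ⟨⟨y, hy, hyi⟩, hw⟩ := hw i
  have hlt : (x i - v i).val < (w i - v i).val := by
    rw [hxi, sub_self]
    exact Nat.pos_of_ne_zero fun h => hi (sub_eq_zero.1 (Fin.ext h)).symm
  refine (hyi ▸ hB.induction (fun z => (z i - v i).val < (w i - v i).val)
    (fun e he => ?_) hx hy hlt).false
  have hev : e.1 i ≠ v i - 1 := hv _ (src_mem_vertices he)
  have hew : e.1 i ≠ w i - 1 := hw _ (src_mem_vertices he)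
  rw [lattice_tgt_apply]
  change (e.1 i - v i).val < _ ↔ _
  split_ifs
  · have hval := val_add_one_sub hev
    have hvalw : (e.1 i + 1 - v i).val ≠ (w i - v i).val := fun h =>
      hew (eq_sub_of_add_eq (sub_left_injective (Fin.ext h)))
    omega
  · rfl

theorem isHomOn_wrap (v : ι → Fin (n + 2)) (C : Finset ((ι → ℕ) × ι)) :
    IsHomOn (lattice ℕ ι) (lattice (Fin (n + 2)) ι) (wrapEdge v) (wrapVertex v) C := by
  refine fun e _ => ⟨rfl, funext fun i => ?_⟩
  rw [wrapVertex, lattice_tgt_apply, lattice_tgt_apply]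
  change (if i = e.2 then v i + (e.1 i : Fin (n + 2)) + 1 else v i + (e.1 i : Fin (n + 2))) = _
  split_ifs
  · rw [Nat.cast_add, Nat.cast_one, add_assoc]
  · rfl

theorem IsCorner.isHomOn_unwrap (hv : IsCorner v B) :
    IsHomOn (lattice (Fin (n + 2)) ι) (lattice ℕ ι) (unwrapEdge v) (unwrapVertex v) B := by
  refine fun e he => ⟨rfl, funext fun i => ?_⟩
  rw [unwrapVertex, lattice_tgt_apply, lattice_tgt_apply]
  change (if i = e.2 then (e.1 i - v i).val + 1 else (e.1 i - v i).val) = _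
  split_ifs
  · exact (val_add_one_sub ((hv i).2 _ (src_mem_vertices he))).symm
  · rfl

variable {j : ℕ} {C : Finset ((ι → ℕ) × ι)}

theorem IsRootedShape.leftInvOn_unwrapVertex (hC : IsRootedShape j C) (hj : j ≤ n)
    (v : ι → Fin (n + 2)) :
    Set.LeftInvOn (unwrapVertex v) (wrapVertex v) ((lattice ℕ ι).vertices C) := fun _ hx =>
  unwrapVertex_wrapVertex v fun i => ((hC.apply_le hx i).trans hj).trans n.le_succ

theorem IsRootedShape.leftInvOn_unwrapEdge (hC : IsRootedShape j C) (hj : j ≤ n)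
    (v : ι → Fin (n + 2)) : Set.LeftInvOn (unwrapEdge v) (wrapEdge v) C := fun _ he =>
  Prod.ext (hC.leftInvOn_unwrapVertex hj v (src_mem_vertices he)) rfl

variable [Fintype ι]

theorem image_wrapEdge_image_unwrapEdge (v : ι → Fin (n + 2))
    (B : Finset ((ι → Fin (n + 2)) × ι)) :
    (B.image (unwrapEdge v)).image (wrapEdge v) = B :=
  image_image_of_leftInvOn fun e _ => Prod.ext (wrapVertex_unwrapVertex v e.1) rfl

theorem IsCorner.isRootedShape_image (hv : IsCorner v B)
    (hB : (lattice (Fin (n + 2)) ι).Connected B)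
    (hrank : (lattice (Fin (n + 2)) ι).rank B ≤ j) : IsRootedShape j (B.image (unwrapEdge v)) where
  connected := hv.isHomOn_unwrap.connected_image hB
  rank_le := hv.isHomOn_unwrap.rank_image_le.trans hrank
  exists_zero i := by
    obtain ⟨x, hx, hxi⟩ := (hv i).1
    rw [hv.isHomOn_unwrap.vertices_image]
    exact ⟨_, ⟨x, hx, rfl⟩, by rw [unwrapVertex, hxi, sub_self, Fin.val_zero]⟩

theorem IsRootedShape.isCorner_image (hC : IsRootedShape j C) (hj : j ≤ n)
    (v : ι → Fin (n + 2)) : IsCorner v (C.image (wrapEdge v)) := by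
  intro i
  rw [(isHomOn_wrap v C).vertices_image]
  refine ⟨?_, ?_⟩
  · obtain ⟨x, hx, hxi⟩ := hC.exists_zero i
    exact ⟨_, ⟨x, hx, rfl⟩, by rw [wrapVertex, hxi, Nat.cast_zero, add_zero]⟩
  · rintro _ ⟨x, hx, rfl⟩ h
    have hxi := hC.apply_le hx i
    rw [wrapVertex, sub_eq_add_neg, add_right_inj, Fin.ext_iff, Fin.coe_neg_one,
      Fin.val_cast_of_lt (by omega)] at h
    omega

theorem IsRootedShape.injOn_image_wrapEdge (hj : j ≤ n) :
    Set.InjOn (fun p : (ι → Fin (n + 2)) × Finset ((ι → ℕ) × ι) => p.2.image (wrapEdge p.1))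
      {p | IsRootedShape j p.2} := by
  rintro ⟨v, C⟩ (hC : IsRootedShape j C) ⟨w, D⟩ (hD : IsRootedShape j D)
    (h : C.image (wrapEdge v) = D.image (wrapEdge w))
  have hvw : v = w := (hC.isCorner_image hj v).unique
    ((isHomOn_wrap v C).connected_image hC.connected) (h ▸ hD.isCorner_image hj w)
  subst hvw
  rw [← image_image_of_leftInvOn (hC.leftInvOn_unwrapEdge hj v), h,
    image_image_of_leftInvOn (hD.leftInvOn_unwrapEdge hj v)]

/-- The sum of the degree `j` cluster weights over the connected edge sets of the infinite grid, per
translation class. -/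
noncomputable def latticeDensity (ι : Type*) [DecidableEq ι] [Fintype ι] (j : ℕ) : ℚ :=
  ∑ C ∈ rootedShapes ι j, PowerSeries.coeff j (clusterWeight (lattice ℕ ι).rank C)

theorem coeff_eulerLogDeriv_rankSeries_torus (hj : j ≤ n) :
    PowerSeries.coeff j (eulerLogDeriv (rankSeries (lattice (Fin (n + 2)) ι).rank univ))
      = ((n + 2 : ℕ) : ℚ) ^ Fintype.card ι * latticeDensity ι j := by
  classical
  rw [loopless_lattice.coeff_eulerLogDeriv]
  trans ∑ p ∈ (univ : Finset (ι → Fin (n + 2))) ×ˢ rootedShapes ι j,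
    PowerSeries.coeff j (clusterWeight (lattice ℕ ι).rank p.2)
  · refine (sum_nbij (fun p => p.2.image (wrapEdge p.1)) ?_ ?_ ?_ ?_).symm
    · rintro ⟨v, C⟩ hp
      have hC := mem_rootedShapes.1 (mem_product.1 hp).2
      exact mem_filter.2 ⟨mem_powerset.2 (subset_univ _),
        (isHomOn_wrap v C).connected_image hC.connected,
        (isHomOn_wrap v C).rank_image_le.trans hC.rank_le⟩
    · exact (IsRootedShape.injOn_image_wrapEdge hj).mono fun p hp =>
        mem_rootedShapes.1 (mem_product.1 hp).2
    · rintro B hB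
      obtain ⟨hconn, hrank⟩ := (mem_filter.1 hB).2
      obtain ⟨v, hv⟩ := hconn.exists_isCorner (hrank.trans hj)
      exact ⟨(v, B.image (unwrapEdge v)), mem_product.2 ⟨mem_univ _,
        mem_rootedShapes.2 (hv.isRootedShape_image hconn hrank)⟩,
        image_wrapEdge_image_unwrapEdge v B⟩
    · rintro ⟨v, C⟩ hp
      have hC := mem_rootedShapes.1 (mem_product.1 hp).2
      dsimp only
      rw [(isHomOn_wrap v C).clusterWeight_image (hC.leftInvOn_unwrapEdge hj v)
        (hC.leftInvOn_unwrapVertex hj v)]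
  · rw [sum_product]
    dsimp only
    rw [sum_const, card_univ, Fintype.card_fun, Fintype.card_fin, nsmul_eq_mul,
      latticeDensity, Nat.cast_pow]

theorem exists_polynomial_coeff_rankSeries_torus (ι : Type*) [DecidableEq ι] [Fintype ι] (r : ℕ) :
    ∃ φ : ℚ[X], ∀ n, r ≤ n →
      PowerSeries.coeff r (rankSeries (lattice (Fin (n + 2)) ι).rank univ)
        = φ.eval ((n + 2 : ℕ) : ℚ) := by
  obtain ⟨φ, hφ⟩ := exists_polynomial_coeff_of_eulerLogDeriv
    (fun j => Polynomial.X ^ Fintype.card ι * Polynomial.C (latticeDensity ι j)) r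
  refine ⟨φ, fun n hr => hφ _ _
    (constantCoeff_rankSeries loopless_lattice.rank_eq_zero_iff _) fun j hj => ?_⟩
  rw [coeff_eulerLogDeriv_rankSeries_torus (hj.trans hr), eval_mul, eval_pow, eval_X, eval_C]

end Torus

section CartesianPower

open scoped Fin.CommRing

variable {k n : ℕ}

theorem cycleGraph_adj_iff_eq_add_one {a b : Fin (n + 2)} :
    (SimpleGraph.cycleGraph (n + 2)).Adj a b ↔ b = a + 1 ∨ a = b + 1 := by
  rw [SimpleGraph.cycleGraph_adj, sub_eq_iff_eq_add', sub_eq_iff_eq_add', or_comm]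

theorem toSimpleGraph_lattice_fin :
    (lattice (Fin (n + 2)) (Fin k)).toSimpleGraph
      = (SimpleGraph.cycleGraph (n + 2)).cartesianPower k := by
  ext x y
  constructor
  · rintro ⟨-, ⟨⟨_, i⟩, rfl, h⟩ | ⟨⟨_, i⟩, rfl, h⟩⟩
    · obtain ⟨hi, h⟩ := lattice_tgt_eq_iff.1 h
      exact ⟨i, cycleGraph_adj_iff_eq_add_one.2 (Or.inl hi), h⟩
    · obtain ⟨hi, h⟩ := lattice_tgt_eq_iff.1 h
      exact ⟨i, cycleGraph_adj_iff_eq_add_one.2 (Or.inr hi), fun j hj => (h j hj).symm⟩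
  · intro hxy
    refine ⟨hxy.ne, ?_⟩
    obtain ⟨i, hi | hi, h⟩ := hxy.imp fun _ => And.imp_left cycleGraph_adj_iff_eq_add_one.1
    · exact Or.inl ⟨(x, i), rfl, lattice_tgt_eq_iff.2 ⟨hi, h⟩⟩
    · exact Or.inr ⟨(y, i), rfl, lattice_tgt_eq_iff.2 ⟨hi, fun j hj => (h j hj).symm⟩⟩

end CartesianPower

end Multigraph

section DartMultigraph

variable {V : Type*} (H : SimpleGraph V)

/-- The multigraph with one edge for each orientation of each edge of a simple graph. It serves to
apply the results on chromatic polynomials of multigraphs to simple graphs. -/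
def dartMultigraph : Multigraph H.Dart V where
  src d := d.fst
  tgt d := d.snd

theorem loopless_dartMultigraph : (dartMultigraph H).Loopless :=
  fun d => d.adj.ne

theorem toSimpleGraph_dartMultigraph : (dartMultigraph H).toSimpleGraph = H := by
  ext u v
  constructor
  · rintro ⟨-, ⟨d, rfl, rfl⟩ | ⟨d, rfl, rfl⟩⟩
    exacts [d.adj, d.adj.symm]
  · exact fun h => ⟨h.ne, Or.inl ⟨⟨(u, v), h⟩, rfl, rfl⟩⟩

variable [Finite V]

instance finite_dart : Finite H.Dart :=
  Finite.of_injective _ SimpleGraph.Dart.toProd_injective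

theorem natDegree_chromaticPolynomial : H.chromaticPolynomial.natDegree = Nat.card V := by
  have hdegree := (loopless_dartMultigraph H).natDegree_chromaticPolynomial
  rwa [toSimpleGraph_dartMultigraph] at hdegree

theorem chromaticPolynomial_monic : H.chromaticPolynomial.Monic := by
  have hmonic := (loopless_dartMultigraph H).chromaticPolynomial_monic
  rwa [toSimpleGraph_dartMultigraph] at hmonic

end DartMultigraph

theorem exists_polynomial_codegreeCoeff_cartesianPower_cycleGraph (k r : ℕ) :
    ∃ φ : ℚ[X], ∀ q : ℕ, r + 2 ≤ q →
      codegreeCoeff ((SimpleGraph.cycleGraph q).cartesianPower k).chromaticPolynomial r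
        = φ.eval (q : ℚ) := by
  obtain ⟨φ, hφ⟩ := Multigraph.exists_polynomial_coeff_rankSeries_torus (Fin k) r
  refine ⟨φ, fun q hq => ?_⟩
  obtain ⟨n, rfl⟩ := Nat.exists_eq_add_of_le' ((Nat.le_add_left 2 r).trans hq)
  rw [← Multigraph.toSimpleGraph_lattice_fin,
    Multigraph.loopless_lattice.codegreeCoeff_chromaticPolynomial, hφ n (by omega)]

theorem mainTheorem8 (k : ℕ) :
    IsTwoLevelPolynomial
      (X ^ k)
      (fun q : ℕ => ((max ((q : ℤ) - 2) (-1) : ℤ) : WithTop ℤ))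
      (fun q : ℕ => ((SimpleGraph.cycleGraph q).cartesianPower k).chromaticPolynomial) := by
  have heval (q : ℕ) : (X ^ k : ℚ[X]).eval (q : ℚ) = (q ^ k : ℕ) := by
    rw [eval_pow, eval_X, Nat.cast_pow]
  have hnonneg (q : ℕ) : 0 ≤ (X ^ k : ℚ[X]).eval (q : ℚ) := heval q ▸ Nat.cast_nonneg _
  choose φ hφ using exists_polynomial_codegreeCoeff_cartesianPower_cycleGraph k
  exact
    { numerical := fun z => ⟨z ^ k, by rw [eval_pow, eval_X, Int.cast_pow]⟩
      eventually_nonneg := Filter.Eventually.of_forall hnonneg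
      neg_one_le_depth := fun q => WithTop.coe_le_coe.2 (le_max_right _ _)
      zero_of_neg := fun q hq => absurd (hnonneg q) (not_le.2 hq)
      degree_eq := fun q _ => ⟨(chromaticPolynomial_monic _).ne_zero, by
        rw [heval, natDegree_chromaticPolynomial, Nat.card_fun, Nat.card_fin, Nat.card_fin]⟩
      exists_coeff := ⟨φ, fun q _ r hr => hφ r q (by
        rw [WithTop.coe_le_coe] at hr
        omega)⟩ }
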